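/- Let $c$ be a positive integer and let $a,b\ge 5$ be odd integers with $(a,b)\neq(5,5)$. Then there exists a signed magic array set $\mathrm{SMAS}(a,b;2c)$. Here, for positive integers $a,b,e$, a signed magic array set $\mathrm{SMAS}(a,b;e)$ is a set of $e$ (completely filled) arrays of size $a\times b$ with entries in $\Omega\subset\mathbb{Z}$, where $\Omega=\{0,\pm1,\pm2,\ldots,\pm(abe-1)/2\}$ if $abe$ is odd and $\Omega=\{\pm1,\pm2,\ldots,\pm abe/2\}$ if $abe$ is even, such that (a) every $\omega\in\Omega$ appears exactly once, and in a unique array; (b) in every array, the sum of the elements of each row and of each column is $0$. In particular, for $e=2c$ the entries are exactly the integers $\pm1,\pm2,\ldots,\pm abc$, each used once. -/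

import Mathlib

/-- The symmetric set of `N` integers: `{0, ±1, …, ±(N-1)/2}` if `N` is odd,
`{±1, …, ±N/2}` if `N` is even. -/
def signedSymbols (N : ℕ) : Set ℤ :=
  {x | if Odd N then |x| ≤ ((N : ℤ) - 1) / 2 else x ≠ 0 ∧ |x| ≤ (N : ℤ) / 2}

/-- The arrays `A 0, …, A (e-1)`, of size `a × b`, form a signed magic array set `SMAS(a,b;e)`.
For `a, b ≥ 1` the field `exists_unique` forces the `e` arrays to be pairwise distinct,
so that they form a set of exactly `e` arrays. -/
structure IsSignedMagicArraySet (a b e : ℕ) (A : Fin e → Matrix (Fin a) (Fin b) ℤ) : Prop where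
  mem_symbols : ∀ t i j, A t i j ∈ signedSymbols (a * b * e)
  exists_unique : ∀ ω ∈ signedSymbols (a * b * e),
    ∃! p : Fin e × Fin a × Fin b, A p.1 p.2.1 p.2.2 = ω
  row_sum : ∀ t i, ∑ j, A t i j = 0
  col_sum : ∀ t j, ∑ i, A t i j = 0

/-! Write a = 3 + 2α, b = 3 + 2β, and cut every array into a 3 × 3 core, strips of sizes 3 × 2β and
2α × 3, and a 2α × 2β block, each with zero row and column sums. A triple {x, y, x + y} with its
negatives fills a 3 × 2 piece of a strip, two pairs of consecutive integers fill a 2 × 4 piece of a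
block, and a run fills a 3 × 3 core and its negative. With p = c(α + β) and w = αβc, it remains to
partition {1, …, 9c + 6p + 4w} into c runs, 2p triples and 2w pairs.

The partition is of Langford type (`tiled_runs`). Runs with growing distances are nested in two
concentric families. The two central gaps are filled by small explicit tilings (`GapTiling`), except
for one position that enters a last triple; what remains falls into pairs. Surplus runs break into
three triples each.

Runs, triples and an even number of pairs have even sum, so this fails when 1 + ⋯ + abc is odd. Then
four triples give way to two 3 × 4 arrays of odd total (`zeroSumArrays_three_four`). If α and β are
both odd, the blocks also need 2 × 6 pieces, built from pairs at distance two; these are cut from an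
interval kept in reserve. -/

/-- The set `S` is the set of entries, without repetition, of `e` integer arrays of size `m × n`
all of whose row sums and column sums vanish. -/
def ZeroSumArrays (e m n : ℕ) (S : Set ℤ) : Prop :=
  ∃ A : Fin e → Fin m → Fin n → ℤ,
    (∀ t i, ∑ j, A t i j = 0) ∧ (∀ t j, ∑ i, A t i j = 0) ∧
    Function.Injective (fun q : Fin e × Fin m × Fin n => A q.1 q.2.1 q.2.2) ∧
    Set.range (fun q : Fin e × Fin m × Fin n => A q.1 q.2.1 q.2.2) = S

/-! ### Gluing and cutting families of zero-sum arrays -/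

namespace ZeroSumArrays

theorem of_fintype {E M N : Type*} [Fintype E] [Fintype M] [Fintype N] {e m n : ℕ} {S : Set ℤ}
    (hE : Fintype.card E = e) (hM : Fintype.card M = m) (hN : Fintype.card N = n)
    (A : E → M → N → ℤ) (hrow : ∀ t i, ∑ j, A t i j = 0) (hcol : ∀ t j, ∑ i, A t i j = 0)
    (hinj : Function.Injective (fun q : E × M × N => A q.1 q.2.1 q.2.2))
    (hran : Set.range (fun q : E × M × N => A q.1 q.2.1 q.2.2) = S) :
    ZeroSumArrays e m n S := by
  let fE := (Fintype.equivFinOfCardEq hE).symm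
  let fM := (Fintype.equivFinOfCardEq hM).symm
  let fN := (Fintype.equivFinOfCardEq hN).symm
  let f := fE.prodCongr (fM.prodCongr fN)
  refine ⟨fun t i j => A (fE t) (fM i) (fN j), fun t i => ?_, fun t j => ?_, ?_, ?_⟩
  · rw [← hrow (fE t) (fM i)]
    exact Equiv.sum_comp fN (fun j => A (fE t) (fM i) j)
  · rw [← hcol (fE t) (fN j)]
    exact Equiv.sum_comp fM (fun i => A (fE t) i (fN j))
  · exact hinj.comp f.injective
  · rw [← hran]
    exact f.surjective.range_comp (fun q : E × M × N => A q.1 q.2.1 q.2.2)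

theorem transpose {e m n : ℕ} {S : Set ℤ} (h : ZeroSumArrays e m n S) :
    ZeroSumArrays e n m S := by
  obtain ⟨A, hrow, hcol, hinj, hran⟩ := h
  let f : Fin e × Fin n × Fin m ≃ Fin e × Fin m × Fin n :=
    (Equiv.refl _).prodCongr (Equiv.prodComm _ _)
  refine ⟨fun t i j => A t j i, fun t i => hcol t i, fun t j => hrow t j,
    hinj.comp f.injective, ?_⟩
  rw [← hran]
  exact f.surjective.range_comp (fun q : Fin e × Fin m × Fin n => A q.1 q.2.1 q.2.2)

theorem of_no_arrays (m n : ℕ) : ZeroSumArrays 0 m n ∅ :=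
  ⟨fun _ _ _ => 0, fun t => t.elim0, fun t => t.elim0, fun q => q.1.elim0, by
    rw [Set.range_eq_empty]⟩

theorem hcat {e m n₁ n₂ : ℕ} {S₁ S₂ : Set ℤ} (h₁ : ZeroSumArrays e m n₁ S₁)
    (h₂ : ZeroSumArrays e m n₂ S₂) (hd : Disjoint S₁ S₂) :
    ZeroSumArrays e m (n₁ + n₂) (S₁ ∪ S₂) := by
  obtain ⟨A, hrow, hcol, hinj, rfl⟩ := h₁
  obtain ⟨B, hrow', hcol', hinj', rfl⟩ := h₂
  rw [Set.disjoint_left] at hd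
  refine of_fintype (E := Fin e) (M := Fin m) (N := Fin n₁ ⊕ Fin n₂) (by simp) (by simp) (by simp)
    (fun t i => Sum.elim (A t i) (B t i)) ?_ ?_ ?_ ?_
  · intro t i
    simp [Fintype.sum_sum_type, hrow, hrow']
  · rintro t (j | j)
    · simpa using hcol t j
    · simpa using hcol' t j
  · rintro ⟨t, i, j | j⟩ ⟨t', i', j' | j'⟩ h
    · have := @hinj (t, i, j) (t', i', j') h
      simp_all
    · exact (hd ⟨(t, i, j), rfl⟩ ⟨(t', i', j'), h.symm⟩).elim
    · exact (hd ⟨(t', i', j'), rfl⟩ ⟨(t, i, j), h⟩).elim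
    · have := @hinj' (t, i, j) (t', i', j') h
      simp_all
  · ext z
    constructor
    · rintro ⟨⟨t, i, j | j⟩, rfl⟩
      · exact Or.inl ⟨(t, i, j), rfl⟩
      · exact Or.inr ⟨(t, i, j), rfl⟩
    · rintro (⟨⟨t, i, j⟩, rfl⟩ | ⟨⟨t, i, j⟩, rfl⟩)
      · exact ⟨(t, i, Sum.inl j), rfl⟩
      · exact ⟨(t, i, Sum.inr j), rfl⟩

theorem vcat {e m₁ m₂ n : ℕ} {S₁ S₂ : Set ℤ} (h₁ : ZeroSumArrays e m₁ n S₁)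
    (h₂ : ZeroSumArrays e m₂ n S₂) (hd : Disjoint S₁ S₂) :
    ZeroSumArrays e (m₁ + m₂) n (S₁ ∪ S₂) :=
  (h₁.transpose.hcat h₂.transpose hd).transpose

theorem append {e₁ e₂ m n : ℕ} {S₁ S₂ : Set ℤ} (h₁ : ZeroSumArrays e₁ m n S₁)
    (h₂ : ZeroSumArrays e₂ m n S₂) (hd : Disjoint S₁ S₂) :
    ZeroSumArrays (e₁ + e₂) m n (S₁ ∪ S₂) := by
  obtain ⟨A, hrow, hcol, hinj, rfl⟩ := h₁
  obtain ⟨B, hrow', hcol', hinj', rfl⟩ := h₂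
  rw [Set.disjoint_left] at hd
  refine of_fintype (E := Fin e₁ ⊕ Fin e₂) (M := Fin m) (N := Fin n) (by simp) (by simp) (by simp)
    (Sum.elim A B) ?_ ?_ ?_ ?_
  · rintro (t | t) i
    · exact hrow t i
    · exact hrow' t i
  · rintro (t | t) j
    · exact hcol t j
    · exact hcol' t j
  · rintro ⟨t | t, i, j⟩ ⟨t' | t', i', j'⟩ h
    · have := @hinj (t, i, j) (t', i', j') h
      simp_all
    · exact (hd ⟨(t, i, j), rfl⟩ ⟨(t', i', j'), h.symm⟩).elim
    · exact (hd ⟨(t', i', j'), rfl⟩ ⟨(t, i, j), h⟩).elim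
    · have := @hinj' (t, i, j) (t', i', j') h
      simp_all
  · ext z
    constructor
    · rintro ⟨⟨t | t, i, j⟩, rfl⟩
      · exact Or.inl ⟨(t, i, j), rfl⟩
      · exact Or.inr ⟨(t, i, j), rfl⟩
    · rintro (⟨⟨t, i, j⟩, rfl⟩ | ⟨⟨t, i, j⟩, rfl⟩)
      · exact ⟨(Sum.inl t, i, j), rfl⟩
      · exact ⟨(Sum.inr t, i, j), rfl⟩

/-- A single array need not contain the negatives of its entries, so the two parts are known only as
sets of integers, not as signed sets. -/
theorem split {e₁ e₂ m n : ℕ} {S : Set ℤ} (h : ZeroSumArrays (e₁ + e₂) m n S) :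
    ∃ S₁ S₂, ZeroSumArrays e₁ m n S₁ ∧ ZeroSumArrays e₂ m n S₂ ∧ Disjoint S₁ S₂ ∧
      S₁ ∪ S₂ = S := by
  obtain ⟨A, hrow, hcol, hinj, rfl⟩ := h
  refine ⟨_, _, ⟨fun t => A (Fin.castAdd e₂ t), fun t => hrow _, fun t => hcol _, ?_, rfl⟩,
    ⟨fun t => A (Fin.natAdd e₁ t), fun t => hrow _, fun t => hcol _, ?_, rfl⟩, ?_, ?_⟩
  · rintro ⟨t, i, j⟩ ⟨t', i', j'⟩ h
    have := @hinj (Fin.castAdd e₂ t, i, j) (Fin.castAdd e₂ t', i', j') h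
    simp_all
  · rintro ⟨t, i, j⟩ ⟨t', i', j'⟩ h
    have := @hinj (Fin.natAdd e₁ t, i, j) (Fin.natAdd e₁ t', i', j') h
    simp_all
  · rw [Set.disjoint_left]
    rintro _ ⟨⟨t, i, j⟩, rfl⟩ ⟨⟨t', i', j'⟩, h⟩
    have := @hinj (Fin.natAdd e₁ t', i', j') (Fin.castAdd e₂ t, i, j) h
    have h1 := congrArg (fun q => (Prod.fst q).val) this
    simp only [Fin.val_natAdd, Fin.val_castAdd] at h1
    omega
  · ext z
    constructor
    · rintro (⟨⟨t, i, j⟩, rfl⟩ | ⟨⟨t, i, j⟩, rfl⟩)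
      · exact ⟨(Fin.castAdd e₂ t, i, j), rfl⟩
      · exact ⟨(Fin.natAdd e₁ t, i, j), rfl⟩
    · rintro ⟨⟨t, i, j⟩, rfl⟩
      induction t using Fin.addCases with
      | left t => exact Or.inl ⟨(t, i, j), rfl⟩
      | right t => exact Or.inr ⟨(t, i, j), rfl⟩

/-- Arrays can be joined side by side, `f` at a time. -/
theorem join {e f m n : ℕ} {S : Set ℤ} (h : ZeroSumArrays (e * f) m n S) :
    ZeroSumArrays e m (f * n) S := by
  obtain ⟨A, hrow, hcol, hinj, rfl⟩ := h
  let g : Fin e × Fin m × (Fin f × Fin n) ≃ Fin (e * f) × Fin m × Fin n :=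
    { toFun := fun q => (finProdFinEquiv (q.1, q.2.2.1), q.2.1, q.2.2.2)
      invFun := fun q =>
        ((finProdFinEquiv.symm q.1).1, q.2.1, ((finProdFinEquiv.symm q.1).2, q.2.2))
      left_inv := fun q => by simp
      right_inv := fun q => by
        obtain ⟨t, i, j⟩ := q
        simp only [Prod.mk.eta, Equiv.apply_symm_apply] }
  refine of_fintype (E := Fin e) (M := Fin m) (N := Fin f × Fin n) (by simp) (by simp) (by simp)
    (fun t i q => A (finProdFinEquiv (t, q.1)) i q.2) ?_ ?_ (hinj.comp g.injective)
    (g.surjective.range_comp (fun q : Fin (e * f) × Fin m × Fin n => A q.1 q.2.1 q.2.2))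
  · intro t i
    rw [Fintype.sum_prod_type]
    exact Finset.sum_eq_zero fun x _ => hrow (finProdFinEquiv (t, x)) i
  · intro t q
    exact hcol _ q.2

theorem cast {e e' m m' n n' : ℕ} {S S' : Set ℤ} (h : ZeroSumArrays e m n S) (he : e = e')
    (hm : m = m') (hn : n = n') (hS : S = S') : ZeroSumArrays e' m' n' S' := by
  subst he hm hn hS
  exact h

end ZeroSumArrays

/-! ### Signed sets and tilings of finite sets -/

/-- The integers whose absolute value lies in `T`. -/
def signedSet (T : Finset ℕ) : Set ℤ := {z | z.natAbs ∈ T}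

theorem signedSet_union (T₁ T₂ : Finset ℕ) :
    signedSet (T₁ ∪ T₂) = signedSet T₁ ∪ signedSet T₂ := by
  ext z
  simp [signedSet]

theorem signedSet_empty : signedSet ∅ = ∅ := by
  ext z
  simp [signedSet]

theorem disjoint_signedSet {T₁ T₂ : Finset ℕ} (h : Disjoint T₁ T₂) :
    Disjoint (signedSet T₁) (signedSet T₂) := by
  rw [Finset.disjoint_left] at h
  rw [Set.disjoint_left]
  exact fun z h₁ h₂ => h h₁ h₂

namespace ZeroSumArrays

/-- To recognise zero-sum arrays with entries `± T`, each once, it suffices to find every entry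
and to compare cardinalities. -/
theorem of_forall_exists {e m n : ℕ} {T : Finset ℕ} (A : Fin e → Fin m → Fin n → ℤ)
    (hrow : ∀ t i, ∑ j, A t i j = 0) (hcol : ∀ t j, ∑ i, A t i j = 0)
    (hmem : ∀ t i j, (A t i j).natAbs ∈ T) (h0 : 0 ∉ T)
    (hex : ∀ v ∈ T, (∃ t i j, A t i j = (v : ℤ)) ∧ ∃ t i j, A t i j = -(v : ℤ))
    (hcard : e * (m * n) = 2 * T.card) : ZeroSumArrays e m n (signedSet T) := by
  have hran : Set.range (fun q : Fin e × Fin m × Fin n => A q.1 q.2.1 q.2.2) = signedSet T := by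
    ext z
    constructor
    · rintro ⟨q, rfl⟩
      exact hmem _ _ _
    · intro hz
      obtain ⟨⟨t, i, j, h⟩, t', i', j', h'⟩ := hex z.natAbs hz
      rcases Int.natAbs_eq z with hz' | hz'
      · exact ⟨(t, i, j), by rw [hz']; exact h⟩
      · exact ⟨(t', i', j'), by rw [hz']; exact h'⟩
  refine ⟨A, hrow, hcol, ?_, hran⟩
  have him : (Finset.univ.image fun q : Fin e × Fin m × Fin n => A q.1 q.2.1 q.2.2) =
      T.image (fun v : ℕ => (v : ℤ)) ∪ T.image (fun v : ℕ => -(v : ℤ)) := by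
    ext z
    have : z ∈ Set.range (fun q : Fin e × Fin m × Fin n => A q.1 q.2.1 q.2.2) ↔
        z.natAbs ∈ T := by rw [hran]; rfl
    simp only [Finset.mem_image, Finset.mem_univ, true_and, Finset.mem_union]
    rw [show (∃ q : Fin e × Fin m × Fin n, A q.1 q.2.1 q.2.2 = z) ↔ z.natAbs ∈ T from this]
    constructor
    · intro hz
      rcases Int.natAbs_eq z with h | h
      · exact Or.inl ⟨_, hz, h.symm⟩
      · exact Or.inr ⟨_, hz, h.symm⟩
    · rintro (⟨v, hv, rfl⟩ | ⟨v, hv, rfl⟩) <;> simpa using hv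
  have hc : (Finset.univ.image fun q : Fin e × Fin m × Fin n => A q.1 q.2.1 q.2.2).card =
      (Finset.univ : Finset (Fin e × Fin m × Fin n)).card := by
    rw [him, Finset.card_union_of_disjoint, Finset.card_image_of_injective,
      Finset.card_image_of_injective, Finset.card_univ]
    · simp only [Fintype.card_prod, Fintype.card_fin]
      omega
    · intro x y h
      simpa using h
    · intro x y h
      simpa using h
    · rw [Finset.disjoint_left]
      intro z h₁ h₂
      simp only [Finset.mem_image] at h₁ h₂
      obtain ⟨v, hv, rfl⟩ := h₁
      obtain ⟨v', hv', h⟩ := h₂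
      have : v = 0 := by omega
      exact h0 (this ▸ hv)
  have := Finset.card_image_iff.1 hc
  exact fun x y h => this (by simp) (by simp) h

end ZeroSumArrays

/-- `T` is the disjoint union of `k` sets with property `P`. -/
inductive Tiled (P : Finset ℕ → Prop) : ℕ → Finset ℕ → Prop
  | nil : Tiled P 0 ∅
  | cons {k : ℕ} {T R : Finset ℕ} : Tiled P k T → P R → Disjoint T R → Tiled P (k + 1) (T ∪ R)

namespace Tiled

variable {P Q : Finset ℕ → Prop}

theorem single {R : Finset ℕ} (h : P R) : Tiled P 1 R := by
  simpa using Tiled.cons Tiled.nil h (Finset.disjoint_empty_left R)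

theorem append {k l : ℕ} {T U : Finset ℕ} (hT : Tiled P k T) (hU : Tiled P l U)
    (hd : Disjoint T U) : Tiled P (k + l) (T ∪ U) := by
  induction hU with
  | nil => simpa using hT
  | cons hU hR hd' ih =>
    rw [Finset.disjoint_union_right] at hd
    rw [← add_assoc, ← Finset.union_assoc]
    exact Tiled.cons (ih hd.1) hR (Finset.disjoint_union_left.2 ⟨hd.2, hd'⟩)

theorem split {k l : ℕ} {T : Finset ℕ} (h : Tiled P (k + l) T) :
    ∃ T₁ T₂, Tiled P k T₁ ∧ Tiled P l T₂ ∧ Disjoint T₁ T₂ ∧ T₁ ∪ T₂ = T := by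
  induction l generalizing T with
  | zero => exact ⟨T, ∅, h, Tiled.nil, Finset.disjoint_empty_right T, Finset.union_empty T⟩
  | succ l ih =>
    rw [← add_assoc] at h
    cases h with
    | cons hT hR hd =>
      obtain ⟨T₁, T₂, h₁, h₂, hd₂, rfl⟩ := ih hT
      rw [Finset.disjoint_union_left] at hd
      exact ⟨T₁, _, h₁, Tiled.cons h₂ hR hd.2, Finset.disjoint_union_right.2 ⟨hd₂, hd.1⟩,
        (Finset.union_assoc _ _ _).symm⟩

/-- Unite the tiles of two tilings, one to one. -/
theorem zip {k : ℕ} {T U : Finset ℕ} {W : Finset ℕ → Prop} (hT : Tiled P k T) (hU : Tiled Q k U)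
    (hd : Disjoint T U) (hW : ∀ R S, P R → Q S → Disjoint R S → W (R ∪ S)) :
    Tiled W k (T ∪ U) := by
  induction hT generalizing U with
  | nil =>
    cases hU
    simpa using Tiled.nil
  | @cons k T R hT hR hTR ih =>
    cases hU with
    | @cons _ U S hU hS hUS =>
      rw [Finset.disjoint_union_left, Finset.disjoint_union_right, Finset.disjoint_union_right]
        at hd
      rw [Finset.union_union_union_comm]
      refine Tiled.cons (ih hU hd.1.1) (hW R S hR hS hd.2.2) ?_
      rw [Finset.disjoint_union_left, Finset.disjoint_union_right, Finset.disjoint_union_right]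
      exact ⟨⟨hTR, hd.1.2⟩, hd.2.1.symm, hUS⟩

theorem bind {k l : ℕ} {T : Finset ℕ} (h : Tiled P k T) (hP : ∀ R, P R → Tiled Q l R) :
    Tiled Q (k * l) T := by
  induction h with
  | nil => simpa using Tiled.nil
  | cons hT hR hd ih =>
    rw [Nat.succ_mul]
    exact ih.append (hP _ hR) hd

theorem of_family {k : ℕ} {R : ℕ → Finset ℕ} (hP : ∀ i < k, P (R i))
    (hd : ∀ i j, i < j → j < k → Disjoint (R i) (R j)) :
    Tiled P k ((Finset.range k).biUnion R) := by
  induction k with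
  | zero => simpa using Tiled.nil
  | succ k ih =>
    rw [Finset.range_add_one, Finset.biUnion_insert, Finset.union_comm]
    refine Tiled.cons (ih (fun i hi => hP i (by omega)) fun i j hij hj => hd i j hij (by omega))
      (hP k (by omega)) ?_
    rw [Finset.disjoint_biUnion_left]
    exact fun i hi => hd i k (Finset.mem_range.1 hi) (by omega)

theorem zeroSumArrays {k e m n : ℕ} {T : Finset ℕ} (h : Tiled P k T)
    (hP : ∀ R, P R → ZeroSumArrays e m n (signedSet R)) :
    ZeroSumArrays (k * e) m n (signedSet T) := by
  induction h with
  | nil => simpa [signedSet_empty] using ZeroSumArrays.of_no_arrays m n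
  | cons hT hR hd ih =>
    rw [Nat.succ_mul, signedSet_union]
    exact ih.append (hP _ hR) (disjoint_signedSet hd)

end Tiled

/-! ### The elementary pieces and their arrays -/

/-- `{x, y, x + y}` -/
def IsTriple (R : Finset ℕ) : Prop :=
  ∃ x y, 0 < x ∧ x < y ∧ R = {x, y, x + y}

/-- Two consecutive positive integers. -/
def IsPair (R : Finset ℕ) : Prop :=
  ∃ x, 0 < x ∧ R = {x, x + 1}

/-- Two positive integers at distance two. -/
def IsWidePair (R : Finset ℕ) : Prop :=
  ∃ x, 0 < x ∧ R = {x, x + 2}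

/-- Two disjoint pairs of consecutive positive integers. -/
def IsQuad (R : Finset ℕ) : Prop :=
  ∃ x y, 0 < x ∧ x + 1 < y ∧ R = {x, x + 1, y, y + 1}

/-- Three intervals of three integers, the first one starting at `u`, the others at distance
`u + 1`. -/
def IsRun (R : Finset ℕ) : Prop :=
  ∃ u m, 2 ≤ u ∧ u + 2 < m ∧
    R = Finset.Icc u (u + 2) ∪ Finset.Icc m (m + 2) ∪ Finset.Icc (m + u + 1) (m + u + 3)

/-- A disjoint union of a wide pair and a quad. -/
def IsSextuple (R : Finset ℕ) : Prop :=
  ∃ S S', IsWidePair S ∧ IsQuad S' ∧ Disjoint S S' ∧ R = S ∪ S'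

theorem IsTriple.zeroSumArrays {R : Finset ℕ} (h : IsTriple R) :
    ZeroSumArrays 1 3 2 (signedSet R) := by
  obtain ⟨x, y, hx, hxy, rfl⟩ := h
  refine ZeroSumArrays.of_forall_exists
    (fun _ => ![![(x : ℤ), -x], ![(y : ℤ), -y], ![-(x + y : ℤ), (x + y : ℤ)]]) ?_ ?_ ?_ ?_ ?_ ?_
  · intro t i
    fin_cases i <;> simp [Fin.sum_univ_succ]
  · intro t j
    fin_cases j <;> simp [Fin.sum_univ_succ]
  · intro t i j
    simp only [Finset.mem_insert, Finset.mem_singleton]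
    fin_cases i <;> fin_cases j <;> simp <;> omega
  · simp only [Finset.mem_insert, Finset.mem_singleton]
    omega
  · intro v hv
    simp only [Finset.mem_insert, Finset.mem_singleton] at hv
    rcases hv with rfl | rfl | rfl
    · exact ⟨⟨0, 0, 0, rfl⟩, 0, 0, 1, rfl⟩
    · exact ⟨⟨0, 1, 0, rfl⟩, 0, 1, 1, rfl⟩
    · exact ⟨⟨0, 2, 1, by simp⟩, 0, 2, 0, by simp⟩
  · rw [Finset.card_eq_three.2 ⟨x, y, x + y, by omega, by omega, by omega, rfl⟩]

theorem IsQuad.card {R : Finset ℕ} (h : IsQuad R) : R.card = 4 := by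
  obtain ⟨x, y, hx, hxy, rfl⟩ := h
  rw [Finset.card_insert_of_notMem, Finset.card_insert_of_notMem, Finset.card_insert_of_notMem,
    Finset.card_singleton] <;> simp <;> omega

theorem IsQuad.zeroSumArrays {R : Finset ℕ} (h : IsQuad R) :
    ZeroSumArrays 1 2 4 (signedSet R) := by
  have hcard := h.card
  obtain ⟨x, y, hx, hxy, rfl⟩ := h
  refine ZeroSumArrays.of_forall_exists
    (fun _ => ![![(x : ℤ), -(x + 1), -y, (y : ℤ) + 1], ![-(x : ℤ), x + 1, y, -((y : ℤ) + 1)]])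
    ?_ ?_ ?_ ?_ ?_ (by rw [hcard])
  · intro t i
    fin_cases i <;> simp [Fin.sum_univ_succ]
  · intro t j
    fin_cases j <;> simp [Fin.sum_univ_succ]
  · intro t i j
    simp only [Finset.mem_insert, Finset.mem_singleton]
    fin_cases i <;> fin_cases j <;> simp <;> omega
  · simp only [Finset.mem_insert, Finset.mem_singleton]
    omega
  · intro v hv
    simp only [Finset.mem_insert, Finset.mem_singleton] at hv
    rcases hv with rfl | rfl | rfl | rfl
    · exact ⟨⟨0, 0, 0, rfl⟩, 0, 1, 0, rfl⟩
    · exact ⟨⟨0, 1, 1, by simp⟩, 0, 0, 1, by simp⟩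
    · exact ⟨⟨0, 1, 2, rfl⟩, 0, 0, 2, rfl⟩
    · exact ⟨⟨0, 0, 3, by simp⟩, 0, 1, 3, by simp⟩

/-- The difference 2 of the wide pair is cancelled by the differences 1 of the two consecutive
pairs; the second row negates the first. -/
theorem IsSextuple.zeroSumArrays {R : Finset ℕ} (h : IsSextuple R) :
    ZeroSumArrays 1 2 6 (signedSet R) := by
  obtain ⟨S, S', ⟨x, hx, rfl⟩, hS', hd, rfl⟩ := h
  have hcard : ({x, x + 2} ∪ S').card = 6 := by
    rw [Finset.card_union_of_disjoint hd, hS'.card, Finset.card_pair (by omega)]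
  obtain ⟨y, z, hy, hyz, rfl⟩ := hS'
  refine ZeroSumArrays.of_forall_exists
    (fun _ => ![![(x : ℤ), -(x + 2), -y, (y : ℤ) + 1, -z, (z : ℤ) + 1],
      ![-(x : ℤ), x + 2, y, -((y : ℤ) + 1), z, -((z : ℤ) + 1)]])
    ?_ ?_ ?_ ?_ ?_ (by rw [hcard])
  · intro t i
    fin_cases i <;> simp [Fin.sum_univ_succ] <;> ring
  · intro t j
    fin_cases j <;> simp [Fin.sum_univ_succ]
  · intro t i j
    simp only [Finset.mem_union, Finset.mem_insert, Finset.mem_singleton]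
    fin_cases i <;> fin_cases j <;> simp <;> omega
  · simp only [Finset.mem_union, Finset.mem_insert, Finset.mem_singleton]
    omega
  · intro v hv
    simp only [Finset.mem_union, Finset.mem_insert, Finset.mem_singleton] at hv
    rcases hv with (rfl | rfl) | rfl | rfl | rfl | rfl
    · exact ⟨⟨0, 0, 0, rfl⟩, 0, 1, 0, rfl⟩
    · exact ⟨⟨0, 1, 1, by simp⟩, 0, 0, 1, by simp⟩
    · exact ⟨⟨0, 1, 2, rfl⟩, 0, 0, 2, rfl⟩
    · exact ⟨⟨0, 0, 3, by simp⟩, 0, 1, 3, by simp⟩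
    · exact ⟨⟨0, 1, 4, rfl⟩, 0, 0, 4, rfl⟩
    · exact ⟨⟨0, 0, 5, by simp⟩, 0, 1, 5, by simp⟩

theorem IsRun.tiled_triples {R : Finset ℕ} (h : IsRun R) : Tiled IsTriple 3 R := by
  obtain ⟨u, m, hu, hm, rfl⟩ := h
  have h₁ : IsTriple {u, m + 1, u + (m + 1)} := ⟨u, m + 1, by omega, by omega, rfl⟩
  have h₂ : IsTriple {u + 1, m + 2, u + 1 + (m + 2)} := ⟨u + 1, m + 2, by omega, by omega, rfl⟩
  have h₃ : IsTriple {u + 2, m, u + 2 + m} := ⟨u + 2, m, by omega, by omega, rfl⟩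
  have h₁₂ := (Tiled.single h₁).append (Tiled.single h₂) (by
    simp only [Finset.disjoint_left, Finset.mem_insert, Finset.mem_singleton]
    omega)
  convert h₁₂.append (Tiled.single h₃) (by
    simp only [Finset.disjoint_left, Finset.mem_union, Finset.mem_insert, Finset.mem_singleton]
    omega) using 1
  ext v
  simp only [Finset.mem_union, Finset.mem_Icc, Finset.mem_insert, Finset.mem_singleton]
  omega

/-- A run splits into three triples in two orthogonal ways, which serve as the rows and the columns
of a 3 × 3 array; the second array is the negative of the first. -/
theorem IsRun.zeroSumArrays {R : Finset ℕ} (h : IsRun R) :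
    ZeroSumArrays 2 3 3 (signedSet R) := by
  obtain ⟨u, m, hu, hm, rfl⟩ := h
  refine ZeroSumArrays.of_forall_exists
    ![![![-((u : ℤ) + 1), m + u + 1, -m], ![-((m : ℤ) + 2), -u, m + u + 2],
      ![(m : ℤ) + u + 3, -(m + 1), -(u + 2)]],
      ![![(u : ℤ) + 1, -(m + u + 1), m], ![(m : ℤ) + 2, u, -(m + u + 2)],
      ![-((m : ℤ) + u + 3), m + 1, u + 2]]] ?_ ?_ ?_ ?_ ?_ ?_
  · intro t i
    fin_cases t <;> fin_cases i <;> simp [Fin.sum_univ_succ] <;> ring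
  · intro t j
    fin_cases t <;> fin_cases j <;> simp [Fin.sum_univ_succ] <;> ring
  · intro t i j
    simp only [Finset.mem_union, Finset.mem_Icc]
    fin_cases t <;> fin_cases i <;> fin_cases j <;> simp <;> omega
  · simp only [Finset.mem_union, Finset.mem_Icc]
    omega
  · intro v hv
    simp only [Finset.mem_union, Finset.mem_Icc] at hv
    have : v = u ∨ v = u + 1 ∨ v = u + 2 ∨ v = m ∨ v = m + 1 ∨ v = m + 2 ∨ v = m + u + 1 ∨
      v = m + u + 2 ∨ v = m + u + 3 := by omega
    rcases this with rfl | rfl | rfl | rfl | rfl | rfl | rfl | rfl | rfl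
    · exact ⟨⟨1, 1, 1, rfl⟩, 0, 1, 1, rfl⟩
    · exact ⟨⟨1, 0, 0, by simp⟩, 0, 0, 0, by simp⟩
    · exact ⟨⟨1, 2, 2, by simp⟩, 0, 2, 2, by simp⟩
    · exact ⟨⟨1, 0, 2, rfl⟩, 0, 0, 2, rfl⟩
    · exact ⟨⟨1, 2, 1, by simp⟩, 0, 2, 1, by simp⟩
    · exact ⟨⟨1, 1, 0, by simp⟩, 0, 1, 0, by simp⟩
    · exact ⟨⟨0, 0, 1, by simp⟩, 1, 0, 1, by simp⟩
    · exact ⟨⟨0, 1, 2, by simp⟩, 1, 1, 2, by simp⟩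
    · exact ⟨⟨0, 2, 0, by simp⟩, 1, 2, 0, by simp⟩
  · rw [Finset.card_union_of_disjoint, Finset.card_union_of_disjoint]
    · simp only [Nat.card_Icc]
      omega
    · simp only [Finset.disjoint_left, Finset.mem_Icc]
      omega
    · simp only [Finset.disjoint_left, Finset.mem_union, Finset.mem_Icc]
      omega

/-- Two `3 × 4` arrays with entries `± T` where, unlike for the other arrays used here, the sum
of `T` is odd. -/
theorem zeroSumArrays_three_four {m : ℕ} (hm : 5 < m) :
    ZeroSumArrays 2 3 4 (signedSet ({1, 2, 3, 5} ∪ Finset.Icc m (m + 7))) := by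
  refine ZeroSumArrays.of_forall_exists
    ![![![1, -1, -2, 2], ![(m : ℤ), m + 5, -m, -(m + 5)],
      ![-((m : ℤ) + 1), -(m + 4), m + 2, m + 3]],
      ![![5, 3, -5, -3], ![(m : ℤ) + 1, m + 4, -(m + 2), -(m + 3)],
      ![-((m : ℤ) + 6), -(m + 7), m + 7, m + 6]]] ?_ ?_ ?_ ?_ ?_ ?_
  · intro t i
    fin_cases t <;> fin_cases i <;> simp [Fin.sum_univ_succ] <;> ring
  · intro t j
    fin_cases t <;> fin_cases j <;> simp [Fin.sum_univ_succ] <;> ring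
  · intro t i j
    simp only [Finset.mem_union, Finset.mem_Icc, Finset.mem_insert, Finset.mem_singleton]
    fin_cases t <;> fin_cases i <;> fin_cases j <;> simp <;> omega
  · simp only [Finset.mem_union, Finset.mem_Icc, Finset.mem_insert, Finset.mem_singleton]
    omega
  · intro v hv
    simp only [Finset.mem_union, Finset.mem_Icc, Finset.mem_insert, Finset.mem_singleton] at hv
    have : v = 1 ∨ v = 2 ∨ v = 3 ∨ v = 5 ∨ v = m ∨ v = m + 1 ∨ v = m + 2 ∨ v = m + 3 ∨
      v = m + 4 ∨ v = m + 5 ∨ v = m + 6 ∨ v = m + 7 := by omega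
    rcases this with rfl | rfl | rfl | rfl | rfl | rfl | rfl | rfl | rfl | rfl | rfl | rfl
    · exact ⟨⟨0, 0, 0, rfl⟩, 0, 0, 1, rfl⟩
    · exact ⟨⟨0, 0, 3, rfl⟩, 0, 0, 2, rfl⟩
    · exact ⟨⟨1, 0, 1, rfl⟩, 1, 0, 3, rfl⟩
    · exact ⟨⟨1, 0, 0, rfl⟩, 1, 0, 2, rfl⟩
    · exact ⟨⟨0, 1, 0, rfl⟩, 0, 1, 2, rfl⟩
    · exact ⟨⟨1, 1, 0, by simp⟩, 0, 2, 0, by simp⟩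
    · exact ⟨⟨0, 2, 2, by simp⟩, 1, 1, 2, by simp⟩
    · exact ⟨⟨0, 2, 3, by simp⟩, 1, 1, 3, by simp⟩
    · exact ⟨⟨1, 1, 1, by simp⟩, 0, 2, 1, by simp⟩
    · exact ⟨⟨0, 1, 1, by simp⟩, 0, 1, 3, by simp⟩
    · exact ⟨⟨1, 2, 3, by simp⟩, 1, 2, 0, by simp⟩
    · exact ⟨⟨1, 2, 2, by simp⟩, 1, 2, 1, by simp⟩
  · rw [Finset.card_union_of_disjoint]
    · simp only [Nat.card_Icc]
      have : ({1, 2, 3, 5} : Finset ℕ).card = 4 := rfl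
      omega
    · simp only [Finset.disjoint_left, Finset.mem_Icc, Finset.mem_insert, Finset.mem_singleton]
      omega

/-! ### Intervals cut into pairs, and nested runs -/

theorem tiled_pairs_Ico (x k : ℕ) (hx : 0 < x) : Tiled IsPair k (Finset.Ico x (x + 2 * k)) := by
  convert Tiled.of_family (P := IsPair) (k := k) (R := fun i => {x + 2 * i, x + 2 * i + 1})
    (fun i _ => ⟨x + 2 * i, by omega, rfl⟩) ?_ using 1
  · ext v
    simp only [Finset.mem_Ico, Finset.mem_biUnion, Finset.mem_range, Finset.mem_insert,
      Finset.mem_singleton]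
    constructor
    · intro hv
      exact ⟨(v - x) / 2, by omega, by omega⟩
    · rintro ⟨i, hi, h⟩
      omega
  · intro i j hij _
    simp only [Finset.disjoint_left, Finset.mem_insert, Finset.mem_singleton]
    omega

/-- Four consecutive integers are two interleaved wide pairs, which is why the number of pairs is
even. -/
theorem tiled_widePairs_Ico (x k : ℕ) (hx : 0 < x) :
    Tiled IsWidePair (2 * k) (Finset.Ico x (x + 4 * k)) := by
  convert Tiled.of_family (P := IsWidePair) (k := 2 * k)
    (R := fun i => {x + 4 * (i / 2) + i % 2, x + 4 * (i / 2) + i % 2 + 2})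
    (fun i _ => ⟨x + 4 * (i / 2) + i % 2, by omega, rfl⟩) ?_ using 1
  · ext v
    simp only [Finset.mem_Ico, Finset.mem_biUnion, Finset.mem_range, Finset.mem_insert,
      Finset.mem_singleton]
    constructor
    · intro hv
      exact ⟨2 * ((v - x) / 4) + (v - x) % 2, by omega, by omega⟩
    · rintro ⟨i, hi, h⟩
      omega
  · intro i j hij _
    simp only [Finset.disjoint_left, Finset.mem_insert, Finset.mem_singleton]
    omega

/-- The runs whose first intervals start at `L + 1, L + 4, L + 7, …` are arranged in two families
of concentric intervals. -/
theorem tiled_runs {L I s a b : ℕ} (hL : 1 ≤ L) (hs : L + 3 * I < s) (ha : a = (I + 1) / 2)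
    (hb : b = I / 2) :
    Tiled IsRun I (Finset.Ico (L + 1) (L + 3 * I + 1) ∪
      (Finset.Ico (s + 1) (s + 3 * a + 1) ∪ Finset.Ico (s + 3 * a + L) (s + 6 * a + L)) ∪
      (Finset.Ico (s + 6 * a + L) (s + 6 * a + 3 * b + L) ∪
        Finset.Ico (s + 6 * a + 3 * b + 2 * L + 2) (s + 6 * a + 6 * b + 2 * L + 2))) := by
  -- `l i` is the start of the middle interval of run `i`. Even indices form the first family and
  -- odd indices the second. Within a family the distance grows by 6 from one run to the next, so
  -- both intervals move outwards by 3.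
  let l : ℕ → ℕ := fun i =>
    (if i % 2 = 0 then s + 3 * a else s + 6 * a + 3 * b + L - 1) - 3 * (i / 2) - 2
  have hl : ∀ i < I, (i % 2 = 0 ∧ l i + 3 * (i / 2) + 2 = s + 3 * a) ∨
      (i % 2 = 1 ∧ l i + 3 * (i / 2) + 3 = s + 6 * a + 3 * b + L) := by
    intro i hi
    simp only [l]
    split_ifs with h <;> omega
  convert Tiled.of_family (P := IsRun) (k := I) (R := fun i =>
    Finset.Icc (L + 1 + 3 * i) (L + 1 + 3 * i + 2) ∪ Finset.Icc (l i) (l i + 2) ∪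
      Finset.Icc (l i + (L + 1 + 3 * i) + 1) (l i + (L + 1 + 3 * i) + 3))
    (fun i hi => ⟨L + 1 + 3 * i, l i, by omega, ?_, rfl⟩) ?_ using 1
  · ext v
    simp only [Finset.mem_union, Finset.mem_Ico, Finset.mem_biUnion, Finset.mem_range,
      Finset.mem_Icc]
    constructor
    · rintro ((h | h | h) | h | h)
      · exact ⟨(v - (L + 1)) / 3, by omega, by omega⟩
      · refine ⟨2 * ((s + 3 * a - v) / 3), by omega, ?_⟩
        have := hl (2 * ((s + 3 * a - v) / 3)) (by omega)
        omega
      · refine ⟨2 * ((v - (s + 3 * a + L)) / 3), by omega, ?_⟩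
        have := hl (2 * ((v - (s + 3 * a + L)) / 3)) (by omega)
        omega
      · refine ⟨2 * ((s + 6 * a + 3 * b + L - 1 - v) / 3) + 1, by omega, ?_⟩
        have := hl (2 * ((s + 6 * a + 3 * b + L - 1 - v) / 3) + 1) (by omega)
        omega
      · refine ⟨2 * ((v - (s + 6 * a + 3 * b + 2 * L + 2)) / 3) + 1, by omega, ?_⟩
        have := hl (2 * ((v - (s + 6 * a + 3 * b + 2 * L + 2)) / 3) + 1) (by omega)
        omega
    · rintro ⟨i, hi, h⟩
      have := hl i hi
      omega
  · have := hl i hi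
    omega
  · intro i j hij hj
    have hi' := hl i (by omega)
    have hj' := hl j hj
    simp only [Finset.disjoint_left, Finset.mem_union, Finset.mem_Icc]
    omega

/-! ### Filling the two central gaps -/

/-- The set `S`, an interval of length `L - 1` and an interval of length `L + 2` with the element
of index `j` removed are together tiled by `t` triples and `q` pairs, wherever the intervals are. -/
def GapTiling (L j t q : ℕ) (S : Finset ℕ) : Prop :=
  ∀ h₁ h₂, L < h₁ → h₁ + L ≤ h₂ + 1 → ∃ U P, Tiled IsTriple t U ∧ Tiled IsPair q P ∧
    Disjoint U P ∧
    U ∪ P = S ∪ (Finset.Ico h₁ (h₁ + (L - 1)) ∪ (Finset.Ico h₂ (h₂ + (L + 2))).erase (h₂ + j))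

theorem Tiled.snoc_triple {k : ℕ} {T : Finset ℕ} (h : Tiled IsTriple k T) (x y : ℕ) (hx : 0 < x)
    (hxy : x < y) (hd : x ∉ T ∧ y ∉ T ∧ x + y ∉ T) :
    Tiled IsTriple (k + 1) (T ∪ {x, y, x + y}) :=
  h.cons ⟨x, y, hx, hxy, rfl⟩ (by simpa [Finset.disjoint_right] using hd)

theorem Tiled.snoc_pair {k : ℕ} {T : Finset ℕ} (h : Tiled IsPair k T) (x : ℕ) (hx : 0 < x)
    (hd : x ∉ T ∧ x + 1 ∉ T) : Tiled IsPair (k + 1) (T ∪ {x, x + 1}) :=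
  h.cons ⟨x, hx, rfl⟩ (by simpa [Finset.disjoint_right] using hd)

/-- In this tiling and the following ones, each triple consists of an element of `S` and two
positions of the same gap at that distance, so the location of the gaps is irrelevant. -/
theorem gapTiling_one : GapTiling 1 0 1 0 {1} := by
  intro h₁ h₂ hh₁ hh₂
  have t0 : Tiled IsTriple 1 {1, h₂ + 1, 1 + (h₂ + 1)} :=
    Tiled.single ⟨_, _, by omega, by omega, rfl⟩
  refine ⟨_, _, t0, Tiled.nil, ?_, ?_⟩
  · exact Finset.disjoint_empty_right _
  · ext v
    simp only [Finset.mem_union, Finset.mem_insert, Finset.mem_singleton, Finset.mem_Ico, Finset.mem_erase, Finset.notMem_empty, or_false]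
    omega

theorem gapTiling_three : GapTiling 3 1 3 0 {1, 2, 3} := by
  intro h₁ h₂ hh₁ hh₂
  have t0 : Tiled IsTriple 1 {1, h₁, 1 + (h₁)} :=
    Tiled.single ⟨_, _, by omega, by omega, rfl⟩
  have t1 := t0.snoc_triple 3 (h₂) (by omega) (by omega) (by
    simp only [Finset.mem_insert, Finset.mem_singleton]
    omega)
  have t2 := t1.snoc_triple 2 (h₂ + 2) (by omega) (by omega) (by
    simp only [Finset.mem_union, Finset.mem_insert, Finset.mem_singleton]
    omega)
  refine ⟨_, _, t2, Tiled.nil, ?_, ?_⟩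
  · exact Finset.disjoint_empty_right _
  · ext v
    simp only [Finset.mem_union, Finset.mem_insert, Finset.mem_singleton, Finset.mem_Ico, Finset.mem_erase, Finset.notMem_empty, or_false]
    omega

theorem gapTiling_five : GapTiling 5 4 5 0 {1, 2, 3, 4, 5} := by
  intro h₁ h₂ hh₁ hh₂
  have t0 : Tiled IsTriple 1 {3, h₁, 3 + (h₁)} :=
    Tiled.single ⟨_, _, by omega, by omega, rfl⟩
  have t1 := t0.snoc_triple 1 (h₁ + 1) (by omega) (by omega) (by
    simp only [Finset.mem_insert, Finset.mem_singleton]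
    omega)
  have t2 := t1.snoc_triple 5 (h₂) (by omega) (by omega) (by
    simp only [Finset.mem_union, Finset.mem_insert, Finset.mem_singleton]
    omega)
  have t3 := t2.snoc_triple 4 (h₂ + 2) (by omega) (by omega) (by
    simp only [Finset.mem_union, Finset.mem_insert, Finset.mem_singleton]
    omega)
  have t4 := t3.snoc_triple 2 (h₂ + 1) (by omega) (by omega) (by
    simp only [Finset.mem_union, Finset.mem_insert, Finset.mem_singleton]
    omega)
  refine ⟨_, _, t4, Tiled.nil, ?_, ?_⟩
  · exact Finset.disjoint_empty_right _
  · ext v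
    simp only [Finset.mem_union, Finset.mem_insert, Finset.mem_singleton, Finset.mem_Ico, Finset.mem_erase, Finset.notMem_empty, or_false]
    omega

/-- Here and for `L` = 7, 9 the values 1, 2, 3, 5 are left to the 3 × 4 arrays. Four triples are
lost, and the eight positions they would occupy form four pairs. -/
theorem gapTiling_five' : GapTiling 5 1 1 4 {4} := by
  intro h₁ h₂ hh₁ hh₂
  have t0 : Tiled IsTriple 1 {4, h₂, 4 + (h₂)} :=
    Tiled.single ⟨_, _, by omega, by omega, rfl⟩
  have p0 : Tiled IsPair 1 {h₁, h₁ + 1} := Tiled.single ⟨_, by omega, rfl⟩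
  have p1 := p0.snoc_pair (h₁ + 2) (by omega) (by
    simp only [Finset.mem_insert, Finset.mem_singleton]
    omega)
  have p2 := p1.snoc_pair (h₂ + 2) (by omega) (by
    simp only [Finset.mem_union, Finset.mem_insert, Finset.mem_singleton]
    omega)
  have p3 := p2.snoc_pair (h₂ + 5) (by omega) (by
    simp only [Finset.mem_union, Finset.mem_insert, Finset.mem_singleton]
    omega)
  refine ⟨_, _, t0, p3, ?_, ?_⟩
  · simp only [Finset.disjoint_left, Finset.mem_union, Finset.mem_insert, Finset.mem_singleton]
    omega
  · ext v
    simp only [Finset.mem_union, Finset.mem_insert, Finset.mem_singleton, Finset.mem_Ico, Finset.mem_erase]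
    omega

theorem gapTiling_seven : GapTiling 7 2 3 4 {4, 6, 7} := by
  intro h₁ h₂ hh₁ hh₂
  have t0 : Tiled IsTriple 1 {7, h₂ + 1, 7 + (h₂ + 1)} :=
    Tiled.single ⟨_, _, by omega, by omega, rfl⟩
  have t1 := t0.snoc_triple 6 (h₂) (by omega) (by omega) (by
    simp only [Finset.mem_insert, Finset.mem_singleton]
    omega)
  have t2 := t1.snoc_triple 4 (h₂ + 3) (by omega) (by omega) (by
    simp only [Finset.mem_union, Finset.mem_insert, Finset.mem_singleton]
    omega)
  have p0 : Tiled IsPair 1 {h₁, h₁ + 1} := Tiled.single ⟨_, by omega, rfl⟩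
  have p1 := p0.snoc_pair (h₁ + 2) (by omega) (by
    simp only [Finset.mem_insert, Finset.mem_singleton]
    omega)
  have p2 := p1.snoc_pair (h₁ + 4) (by omega) (by
    simp only [Finset.mem_union, Finset.mem_insert, Finset.mem_singleton]
    omega)
  have p3 := p2.snoc_pair (h₂ + 4) (by omega) (by
    simp only [Finset.mem_union, Finset.mem_insert, Finset.mem_singleton]
    omega)
  refine ⟨_, _, t2, p3, ?_, ?_⟩
  · simp only [Finset.disjoint_left, Finset.mem_union, Finset.mem_insert, Finset.mem_singleton]
    omega
  · ext v
    simp only [Finset.mem_union, Finset.mem_insert, Finset.mem_singleton, Finset.mem_Ico, Finset.mem_erase]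
    omega

theorem gapTiling_nine : GapTiling 9 3 5 4 {4, 6, 7, 8, 9} := by
  intro h₁ h₂ hh₁ hh₂
  have t0 : Tiled IsTriple 1 {7, h₁, 7 + (h₁)} :=
    Tiled.single ⟨_, _, by omega, by omega, rfl⟩
  have t1 := t0.snoc_triple 9 (h₂) (by omega) (by omega) (by
    simp only [Finset.mem_insert, Finset.mem_singleton]
    omega)
  have t2 := t1.snoc_triple 8 (h₂ + 2) (by omega) (by omega) (by
    simp only [Finset.mem_union, Finset.mem_insert, Finset.mem_singleton]
    omega)
  have t3 := t2.snoc_triple 6 (h₂ + 1) (by omega) (by omega) (by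
    simp only [Finset.mem_union, Finset.mem_insert, Finset.mem_singleton]
    omega)
  have t4 := t3.snoc_triple 4 (h₂ + 4) (by omega) (by omega) (by
    simp only [Finset.mem_union, Finset.mem_insert, Finset.mem_singleton]
    omega)
  have p0 : Tiled IsPair 1 {h₁ + 1, h₁ + 1 + 1} := Tiled.single ⟨_, by omega, rfl⟩
  have p1 := p0.snoc_pair (h₁ + 3) (by omega) (by
    simp only [Finset.mem_insert, Finset.mem_singleton]
    omega)
  have p2 := p1.snoc_pair (h₁ + 5) (by omega) (by
    simp only [Finset.mem_union, Finset.mem_insert, Finset.mem_singleton]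
    omega)
  have p3 := p2.snoc_pair (h₂ + 5) (by omega) (by
    simp only [Finset.mem_union, Finset.mem_insert, Finset.mem_singleton]
    omega)
  refine ⟨_, _, t4, p3, ?_, ?_⟩
  · simp only [Finset.disjoint_left, Finset.mem_union, Finset.mem_insert, Finset.mem_singleton]
    omega
  · ext v
    simp only [Finset.mem_union, Finset.mem_insert, Finset.mem_singleton, Finset.mem_Ico, Finset.mem_erase]
    omega

/-! ### Layouts of `{1, …, N}` -/

/-- A partition of `{1, …, N}` into `c` runs, `n` triples, of which four may be replaced by the
entries of two `3 × 4` arrays, an interval of length `2 * g`, and pairs. -/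
def HasLayout (c n w g N : ℕ) : Prop :=
  ∃ (k q e : ℕ) (K U G P : Finset ℕ), Tiled IsRun c K ∧ Tiled IsTriple k U ∧
    (k = n ∧ G = ∅ ∨ k + 4 = n ∧ ZeroSumArrays 2 3 4 (signedSet G)) ∧
    Tiled IsPair q P ∧ 0 < e ∧ q + g = 2 * w ∧ Disjoint K U ∧ Disjoint (K ∪ U) G ∧
    Disjoint (K ∪ U ∪ G) (Finset.Ico e (e + 2 * g)) ∧
    Disjoint (K ∪ U ∪ G ∪ Finset.Ico e (e + 2 * g)) P ∧
    K ∪ U ∪ G ∪ Finset.Ico e (e + 2 * g) ∪ P = Finset.Icc 1 N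

/-- The parts of a layout cover `{1, …, N}`. -/
theorem mem_layout_iff {L I a b j g r s h₁ h₂ N v : ℕ} (hL : 1 ≤ L) (hab : a + b = I)
    (hs : L + 3 * I < s) (hj : j < L + 2) (hh₁ : h₁ = s + 3 * a + 1)
    (hh₂ : h₂ = s + 6 * a + 3 * b + L) (hg : 2 * g + 1 = 3 * a + j)
    (hN : N = h₂ + j + (L + 3 * I + 1) + 2 * r) :
    1 ≤ v ∧ v ≤ N ↔
      ((L + 1 ≤ v ∧ v < L + 3 * I + 1) ∨ (s + 1 ≤ v ∧ v < h₁) ∨ (h₁ + (L - 1) ≤ v ∧ v < h₂) ∨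
        (h₂ + L + 2 ≤ v ∧ v < h₂ + 3 * b + L + 2)) ∨
      (((h₁ ≤ v ∧ v < h₁ + (L - 1)) ∨ (v ≠ h₂ + j ∧ h₂ ≤ v ∧ v < h₂ + (L + 2))) ∨
        (1 ≤ v ∧ v ≤ L) ∨ (L + 3 * I + 2 ≤ v ∧ v ≤ s)) ∨
      (v = L + 3 * I + 1 ∨ v = h₂ + j ∨ v = L + 3 * I + 1 + (h₂ + j)) ∨
      (h₂ + 3 * b + L + 2 ≤ v ∧ v < h₂ + 3 * b + L + 2 + 2 * g) ∨
      (h₂ + j + (L + 3 * I + 1) + 1 ≤ v ∧ v < h₂ + j + (L + 3 * I + 1) + 1 + 2 * r) := by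
  constructor
  · intro hv
    by_cases c₁ : v ≤ s
    · omega
    by_cases c₂ : v < h₂
    · omega
    by_cases c₃ : v < h₂ + L + 2
    · omega
    omega
  · intro hv
    omega

set_option maxHeartbeats 400000 in
-- The value `L + 3 * I + 1`, just after the first intervals of the runs, and the omitted position
-- `h₂ + j` have a sum beyond the second family. Between that family and this sum lies an interval
-- of `3 * a + j - 1` integers, where `a = (I + 1) / 2`; `hg` makes this number even. It is the
-- reserve of length `2 * g`. The `2 * r` integers after the sum are cut into pairs.
theorem hasLayout_of_gapTiling {c n w g N L I j s t q k : ℕ} {S G : Finset ℕ} (hL : 1 ≤ L)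
    (hgap : GapTiling L j t q S) (hcI : c ≤ I) (hs : L + 3 * I < s) (hj : j < L + 2)
    (hSG : Disjoint S G)
    (hSG' : S ∪ G = Finset.Icc 1 L ∪ Finset.Icc (L + 3 * I + 2) s)
    (hS : ∀ v ∈ S, v ≤ L)
    (hk : k = 3 * (I - c) + (t + 1))
    (hG : k = n ∧ G = ∅ ∨ k + 4 = n ∧ ZeroSumArrays 2 3 4 (signedSet G))
    (hg : 2 * g + 1 = 3 * ((I + 1) / 2) + j)
    (hN : N = s + 6 * ((I + 1) / 2) + 3 * (I / 2) + 2 * L + j + 3 * I + 1 +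
      2 * (2 * w - g - q)) (hw : g + q ≤ 2 * w) :
    HasLayout c n w g N := by
  obtain ⟨a, ha⟩ : ∃ a, a = (I + 1) / 2 := ⟨_, rfl⟩
  obtain ⟨b, hb⟩ : ∃ b, b = I / 2 := ⟨_, rfl⟩
  obtain ⟨r, hr⟩ : ∃ r, r = 2 * w - g - q := ⟨_, rfl⟩
  rw [← ha] at hg
  rw [← ha, ← hb, ← hr] at hN
  have hruns := tiled_runs hL hs ha hb
  -- Only `c` runs are kept for the cores; the other `I - c` are broken into triples.
  rw [show I = c + (I - c) by omega] at hruns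
  obtain ⟨K, K', hK, hK', hKK', hKu⟩ := hruns.split
  rw [show c + (I - c) = I by omega] at hKu
  obtain ⟨h₁, hh₁⟩ : ∃ h₁, h₁ = s + 3 * a + 1 := ⟨_, rfl⟩
  obtain ⟨h₂, hh₂⟩ : ∃ h₂, h₂ = s + 6 * a + 3 * b + L := ⟨_, rfl⟩
  obtain ⟨U, P, hU, hP, hUP, hUPu⟩ := hgap h₁ h₂ (by omega) (by omega)
  have hrange := tiled_pairs_Ico (h₂ + j + (L + 3 * I + 1) + 1) r (by omega)
  have hlast : Tiled IsTriple 1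
      {L + 3 * I + 1, h₂ + j, L + 3 * I + 1 + (h₂ + j)} :=
    Tiled.single ⟨_, _, by omega, by omega, rfl⟩
  have mK : ∀ v, v ∈ K ∨ v ∈ K' ↔ (L + 1 ≤ v ∧ v < L + 3 * I + 1) ∨
      (s + 1 ≤ v ∧ v < h₁) ∨ (h₁ + (L - 1) ≤ v ∧ v < h₂) ∨
      (h₂ + L + 2 ≤ v ∧ v < h₂ + 3 * b + L + 2) := by
    intro v
    have := congrArg (fun X => v ∈ X) hKu
    simp only [Finset.mem_union, Finset.mem_Ico, eq_iff_iff] at this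
    rw [this]
    omega
  have mU : ∀ v, v ∈ U ∨ v ∈ P ↔ v ∈ S ∨ (h₁ ≤ v ∧ v < h₁ + (L - 1)) ∨
      (v ≠ h₂ + j ∧ h₂ ≤ v ∧ v < h₂ + (L + 2)) := by
    intro v
    have := congrArg (fun X => v ∈ X) hUPu
    simp only [Finset.mem_union, Finset.mem_Ico, Finset.mem_erase, eq_iff_iff] at this
    exact this
  have mS : ∀ v, v ∈ S ∨ v ∈ G ↔ (1 ≤ v ∧ v ≤ L) ∨ (L + 3 * I + 2 ≤ v ∧ v ≤ s) := by
    intro v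
    have := congrArg (fun X => v ∈ X) hSG'
    simp only [Finset.mem_union, Finset.mem_Icc, eq_iff_iff] at this
    exact this
  obtain ⟨C, hC⟩ : ∃ C : Finset ℕ, C = {L + 3 * I + 1, h₂ + j, L + 3 * I + 1 + (h₂ + j)} :=
    ⟨_, rfl⟩
  obtain ⟨D, hD⟩ : ∃ D, D = Finset.Ico (h₂ + 3 * b + L + 2) (h₂ + 3 * b + L + 2 + 2 * g) :=
    ⟨_, rfl⟩
  obtain ⟨E, hE⟩ : ∃ E, E = Finset.Ico (h₂ + j + (L + 3 * I + 1) + 1)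
    (h₂ + j + (L + 3 * I + 1) + 1 + 2 * r) := ⟨_, rfl⟩
  rw [← hC] at hlast
  rw [← hE] at hrange
  have iR : ∀ v ∈ K ∪ K', (L + 1 ≤ v ∧ v < L + 3 * I + 1) ∨
      (s + 1 ≤ v ∧ v < h₁) ∨ (h₁ + (L - 1) ≤ v ∧ v < h₂) ∨
      (h₂ + L + 2 ≤ v ∧ v < h₂ + 3 * b + L + 2) :=
    fun v hv => (mK v).1 (Finset.mem_union.1 hv)
  have iU : ∀ v ∈ U ∪ P, v ≤ L ∨ (h₁ ≤ v ∧ v < h₁ + (L - 1)) ∨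
      (v ≠ h₂ + j ∧ h₂ ≤ v ∧ v < h₂ + (L + 2)) := by
    intro v hv
    rcases (mU v).1 (Finset.mem_union.1 hv) with h | h
    · exact Or.inl (hS v h)
    · exact Or.inr h
  have iG : ∀ v ∈ G, (1 ≤ v ∧ v ≤ L) ∨ (L + 3 * I + 2 ≤ v ∧ v ≤ s) :=
    fun v hv => (mS v).1 (Or.inr hv)
  have iC : ∀ v, v ∈ C ↔ v = L + 3 * I + 1 ∨ v = h₂ + j ∨ v = L + 3 * I + 1 + (h₂ + j) := by
    intro v
    rw [hC]
    simp only [Finset.mem_insert, Finset.mem_singleton]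
  have iD : ∀ v, v ∈ D ↔ h₂ + 3 * b + L + 2 ≤ v ∧ v < h₂ + 3 * b + L + 2 + 2 * g := by
    intro v
    rw [hD, Finset.mem_Ico]
  have iE : ∀ v, v ∈ E ↔
      h₂ + j + (L + 3 * I + 1) + 1 ≤ v ∧ v < h₂ + j + (L + 3 * I + 1) + 1 + 2 * r := by
    intro v
    rw [hE, Finset.mem_Ico]
  have dRU : Disjoint (K ∪ K') (U ∪ P) := Finset.disjoint_left.2 fun v h h' => by
    have := iR v h
    have := iU v h'
    omega
  have dRG : Disjoint (K ∪ K') G := Finset.disjoint_left.2 fun v h h' => by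
    have := iR v h
    have := iG v h'
    omega
  have dRC : Disjoint (K ∪ K') C := Finset.disjoint_left.2 fun v h h' => by
    have := iR v h
    have := (iC v).1 h'
    omega
  have dRD : Disjoint (K ∪ K') D := Finset.disjoint_left.2 fun v h h' => by
    have := iR v h
    have := (iD v).1 h'
    omega
  have dRE : Disjoint (K ∪ K') E := Finset.disjoint_left.2 fun v h h' => by
    have := iR v h
    have := (iE v).1 h'
    omega
  have dUG : Disjoint (U ∪ P) G := Finset.disjoint_left.2 fun v h h' => by
    have := iG v h'
    rcases (mU v).1 (Finset.mem_union.1 h) with h | h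
    · exact Finset.disjoint_left.1 hSG h h'
    · omega
  have dUC : Disjoint (U ∪ P) C := Finset.disjoint_left.2 fun v h h' => by
    have := iU v h
    have := (iC v).1 h'
    omega
  have dUD : Disjoint (U ∪ P) D := Finset.disjoint_left.2 fun v h h' => by
    have := iU v h
    have := (iD v).1 h'
    omega
  have dUE : Disjoint (U ∪ P) E := Finset.disjoint_left.2 fun v h h' => by
    have := iU v h
    have := (iE v).1 h'
    omega
  have dGC : Disjoint G C := Finset.disjoint_left.2 fun v h h' => by
    have := iG v h
    have := (iC v).1 h'
    omega
  have dGD : Disjoint G D := Finset.disjoint_left.2 fun v h h' => by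
    have := iG v h
    have := (iD v).1 h'
    omega
  have dGE : Disjoint G E := Finset.disjoint_left.2 fun v h h' => by
    have := iG v h
    have := (iE v).1 h'
    omega
  have dCD : Disjoint C D := Finset.disjoint_left.2 fun v h h' => by
    have := (iC v).1 h
    have := (iD v).1 h'
    omega
  have dCE : Disjoint C E := Finset.disjoint_left.2 fun v h h' => by
    have := (iC v).1 h
    have := (iE v).1 h'
    omega
  have dDE : Disjoint D E := Finset.disjoint_left.2 fun v h h' => by
    have := (iD v).1 h
    have := (iE v).1 h'
    omega
  simp only [Finset.disjoint_union_left, Finset.disjoint_union_right] at dRU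
  rw [Finset.disjoint_union_left] at dRG dRC dRD dRE dUG dUC dUD dUE
  have hU' := ((hK'.bind fun R hR => hR.tiled_triples).append hU dRU.1.2).append hlast
    (Finset.disjoint_union_left.2 ⟨dRC.2, dUC.1⟩)
  refine ⟨_, _, h₂ + 3 * b + L + 2, K, _, G, _, hK, hU', ?_, hP.append hrange dUE.2, by omega,
    by omega, ?_, ?_, ?_, ?_, ?_⟩
  · rw [show (I - c) * 3 + t + 1 = k by omega]
    exact hG
  · simp only [Finset.disjoint_union_right]
    exact ⟨⟨hKK', dRU.1.1⟩, dRC.1⟩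
  · simp only [Finset.disjoint_union_left]
    exact ⟨dRG.1, ⟨dRG.2, dUG.1⟩, dGC.symm⟩
  · rw [← hD]
    simp only [Finset.disjoint_union_left]
    exact ⟨⟨dRD.1, ⟨dRD.2, dUD.1⟩, dCD⟩, dGD⟩
  · rw [← hD]
    simp only [Finset.disjoint_union_left, Finset.disjoint_union_right]
    exact ⟨⟨⟨⟨dRU.2.1, ⟨dRU.2.2, hUP⟩, dUC.2.symm⟩, dUG.2.symm⟩, dUD.2.symm⟩,
      ⟨⟨dRE.1, ⟨dRE.2, dUE.1⟩, dCE⟩, dGE⟩, dDE⟩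
  · rw [← hD]
    ext v
    have hv : v ∈ Finset.Icc 1 N ↔ (v ∈ K ∨ v ∈ K') ∨ ((v ∈ U ∨ v ∈ P) ∨ v ∈ S ∨ v ∈ G) ∨
        v ∈ C ∨ v ∈ D ∨ v ∈ E := by
      rw [mK, mU, mS, iC, iD, iE, Finset.mem_Icc, mem_layout_iff hL (by omega : a + b = I) hs hj
        hh₁ hh₂ hg (show N = _ + 2 * r by omega)]
      -- `S` occurs twice, inside `U ∪ P` and beside `G`; the first occurrence is absorbed by the
      -- range of `S ∪ G`.
      have hSv : v ∈ S → (1 ≤ v ∧ v ≤ L) ∨ (L + 3 * I + 2 ≤ v ∧ v ≤ s) :=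
        fun h => (mS v).1 (Or.inl h)
      refine or_congr_right (or_congr_left ⟨fun h => h.imp_left Or.inr, ?_⟩)
      rintro ((h | h) | h)
      · exact Or.inr (hSv h)
      · exact Or.inl h
      · exact Or.inr h
    rw [hv]
    have hSU : v ∈ S → v ∈ U ∨ v ∈ P := fun h => (mU v).2 (Or.inl h)
    simp only [Finset.mem_union]
    clear * - hSU
    tauto

/-- The equation `hI` counts triples: `3 * (I - c)` from surplus runs, `L` from the gaps and the
last one make `2 * p`. -/
theorem hasLayout_symmetric {c p w L I j : ℕ} {S : Finset ℕ} (hL : 1 ≤ L) (hcI : c ≤ I)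
    (hI : 3 * I + L + 1 = 3 * c + 2 * p) (hj : j < L + 2) (hS : S = Finset.Icc 1 L)
    (hgap : GapTiling L j L 0 S) (hpar : (3 * ((I + 1) / 2) + j) % 2 = 1)
    (hw : 3 * ((I + 1) / 2) + j ≤ 4 * w + 1) :
    HasLayout c (2 * p) w ((3 * ((I + 1) / 2) + j) / 2) (4 * w + 6 * p + 9 * c) := by
  subst hS
  refine hasLayout_of_gapTiling (G := ∅) (s := L + 3 * I + 1) hL hgap hcI (by omega) hj
    (Finset.disjoint_empty_right _) ?_ ?_ rfl (Or.inl ⟨by omega, rfl⟩) (by omega) (by omega)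
    (by omega)
  · rw [Finset.Icc_eq_empty (by omega : ¬ L + 3 * I + 2 ≤ L + 3 * I + 1)]
  · intro v hv
    exact (Finset.mem_Icc.1 hv).2

/-- This is the case of odd total sum. `G` takes 1, 2, 3, 5 and eight integers after `L + 3 * I +
1`, and stands for four of the `2 * p` triples. -/
theorem hasLayout_asymmetric {c p w L I j : ℕ} {S : Finset ℕ} (hL : 5 ≤ L) (hcI : c ≤ I)
    (hI : 3 * I + L + 1 = 3 * c + 2 * p) (hj : j < L + 2)
    (hS : S = (Finset.Icc 1 L) \ {1, 2, 3, 5})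
    (hgap : GapTiling L j (L - 4) 4 S) (hpar : (3 * ((I + 1) / 2) + j) % 2 = 1)
    (hw : 3 * ((I + 1) / 2) + j + 8 ≤ 4 * w + 1) :
    HasLayout c (2 * p) w ((3 * ((I + 1) / 2) + j) / 2) (4 * w + 6 * p + 9 * c) := by
  subst hS
  refine hasLayout_of_gapTiling
    (G := {1, 2, 3, 5} ∪ Finset.Icc (L + 3 * I + 2) (L + 3 * I + 2 + 7))
    (s := L + 3 * I + 9) (by omega) hgap hcI (by omega) hj
    ?_ ?_ ?_ rfl (Or.inr ⟨by omega, zeroSumArrays_three_four (by omega)⟩) (by omega) (by omega)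
    (by omega)
  · simp only [Finset.disjoint_left, Finset.mem_sdiff, Finset.mem_union, Finset.mem_Icc,
      Finset.mem_insert, Finset.mem_singleton]
    omega
  · ext v
    simp only [Finset.mem_sdiff, Finset.mem_union, Finset.mem_Icc,
      Finset.mem_insert, Finset.mem_singleton]
    omega
  · intro v hv
    exact (Finset.mem_Icc.1 (Finset.mem_sdiff.1 hv).1).2

/-- The count of triples determines `L` modulo 3 from `p` modulo 3. The parity of `(I + 1) / 2` then
decides whether the reserve has even length without the 3 × 4 arrays or with them. -/
theorem exists_hasLayout {c p w : ℕ} (hc : 1 ≤ c) (hp : 3 * c ≤ p) (hw : p ≤ w + c) :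
    ∃ g, HasLayout c (2 * p) w g (4 * w + 6 * p + 9 * c) ∧ (4 * c ≤ p → 2 * c ≤ g) := by
  have h3 : p % 3 = 0 ∨ p % 3 = 1 ∨ p % 3 = 2 := by omega
  rcases h3 with h | h | h
  · obtain ⟨I, hI⟩ : ∃ I, 3 * I + 5 + 1 = 3 * c + 2 * p :=
      ⟨(3 * c + 2 * p - 6) / 3, by omega⟩
    by_cases ha : (I + 1) / 2 % 2 = 1
    · exact ⟨_, hasLayout_symmetric (by omega) (by omega) hI (by omega) rfl gapTiling_five
        (by omega) (by omega), by omega⟩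
    · exact ⟨_, hasLayout_asymmetric (by omega) (by omega) hI (by omega) rfl gapTiling_five'
        (by omega) (by
          rcases hc.eq_or_lt with rfl | hc
          -- For `c = 1`, `p = 3` there would be too few pairs, but then `I = 1` and `(I + 1) / 2`
          -- is odd, against `ha`.
          · have : p ≠ 3 := by
              rintro rfl
              omega
            omega
          · omega), by omega⟩
  · obtain ⟨I, hI⟩ : ∃ I, 3 * I + 1 + 1 = 3 * c + 2 * p :=
      ⟨(3 * c + 2 * p - 2) / 3, by omega⟩
    by_cases ha : (I + 1) / 2 % 2 = 1
    · exact ⟨_, hasLayout_symmetric (by omega) (by omega) hI (by omega) rfl gapTiling_one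
        (by omega) (by omega), by omega⟩
    -- Raising `L` by 6 and lowering `I` by 2 preserves the count of triples.
    · obtain ⟨J, rfl⟩ : ∃ J, I = J + 2 := ⟨I - 2, by omega⟩
      exact ⟨_, hasLayout_asymmetric (L := 7) (I := J) (by omega) (by omega) (by omega) (by omega)
        rfl gapTiling_seven (by omega) (by omega), by omega⟩
  · obtain ⟨I, hI⟩ : ∃ I, 3 * I + 3 + 1 = 3 * c + 2 * p :=
      ⟨(3 * c + 2 * p - 4) / 3, by omega⟩
    by_cases ha : (I + 1) / 2 % 2 = 0
    · exact ⟨_, hasLayout_symmetric (by omega) (by omega) hI (by omega) rfl gapTiling_three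
        (by omega) (by omega), by omega⟩
    · obtain ⟨J, rfl⟩ : ∃ J, I = J + 2 := ⟨I - 2, by omega⟩
      exact ⟨_, hasLayout_asymmetric (L := 9) (I := J) (by omega) (by omega) (by omega) (by omega)
        rfl gapTiling_nine (by omega) (by omega), by omega⟩

/-! ### Assembling the even-sized blocks -/

theorem Tiled.quads {k : ℕ} {T : Finset ℕ} (h : Tiled IsPair (k + k) T) : Tiled IsQuad k T := by
  obtain ⟨T₁, T₂, h₁, h₂, hd, rfl⟩ := h.split
  refine h₁.zip h₂ hd ?_
  rintro R S ⟨x, hx, rfl⟩ ⟨y, hy, rfl⟩ hxy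
  simp only [Finset.disjoint_left, Finset.mem_insert, Finset.mem_singleton] at hxy
  have h₁ := @hxy x
  have h₂ := @hxy (x + 1)
  rcases lt_or_ge x y with h | h
  · refine ⟨x, y, hx, by omega, ?_⟩
    ext v
    simp only [Finset.mem_union, Finset.mem_insert, Finset.mem_singleton]
    omega
  · refine ⟨y, x, hy, by omega, ?_⟩
    ext v
    simp only [Finset.mem_union, Finset.mem_insert, Finset.mem_singleton]
    omega

namespace ZeroSumArrays

theorem of_quads_of_even_right {c α y : ℕ} {S : Set ℤ}
    (h : ZeroSumArrays (2 * c * α * y) 2 4 S) :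
    ZeroSumArrays (2 * c) (2 * α) (2 * (2 * y)) S := by
  have h₁ : ZeroSumArrays (2 * c * α) (y * 4) 2 S := h.join.transpose
  exact h₁.join.transpose.cast rfl (by ring) (by ring) rfl

theorem of_quads_of_even_left {c x β : ℕ} {S : Set ℤ}
    (h : ZeroSumArrays (2 * c * β * x) 2 4 S) :
    ZeroSumArrays (2 * c) (2 * (2 * x)) (2 * β) S :=
  (of_quads_of_even_right h).transpose

end ZeroSumArrays

/-- The even-sized blocks. -/
theorem exists_even_blocks {c α β q g e : ℕ} {P : Finset ℕ} (hα : 1 ≤ α) (hβ : 2 ≤ β)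
    (hP : Tiled IsPair q P) (he : 0 < e) (hq : q + g = 2 * (α * β * c))
    (hg : 4 * c ≤ c * (α + β) → 2 * c ≤ g)
    (hd : Disjoint (Finset.Ico e (e + 2 * g)) P) :
    ZeroSumArrays (2 * c) (2 * α) (2 * β) (signedSet (Finset.Ico e (e + 2 * g) ∪ P)) := by
  have hquads : ZeroSumArrays (α * β * c) 2 4 (signedSet (Finset.Ico e (e + 2 * g) ∪ P)) := by
    have h := (tiled_pairs_Ico e g he).append hP hd
    rw [show g + q = α * β * c + α * β * c by omega] at h
    simpa using h.quads.zeroSumArrays fun R hR => hR.zeroSumArrays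
  rcases Nat.even_or_odd' β with ⟨y, rfl | rfl⟩
  · exact ZeroSumArrays.of_quads_of_even_right (hquads.cast (by ring) rfl rfl rfl)
  rcases Nat.even_or_odd' α with ⟨x, rfl | rfl⟩
  · exact ZeroSumArrays.of_quads_of_even_left (hquads.cast (by ring) rfl rfl rfl)
  -- Both `α` and `β` are odd. The width `2β = 4z + 6` leaves 2 modulo 4, so the top two rows of
  -- each block are a 2 × 6 piece and `z` quads; the lower `4x` rows are made of quads turned
  -- upright. Here `α + β ≥ 4`, so the reserve holds the `2c` wide pairs.
  obtain ⟨z, rfl⟩ : ∃ z, y = z + 1 := ⟨y - 1, by omega⟩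
  have hcg : 2 * c ≤ g := hg (by nlinarith)
  have hsplit : Finset.Ico e (e + 2 * g) =
      Finset.Ico e (e + 4 * c) ∪ Finset.Ico (e + 4 * c) (e + 4 * c + 2 * (g - 2 * c)) := by
    ext v
    simp only [Finset.mem_union, Finset.mem_Ico]
    omega
  rw [hsplit] at hd ⊢
  rw [Finset.disjoint_union_left] at hd
  have hwide := tiled_widePairs_Ico e c he
  have hpairs := (tiled_pairs_Ico (e + 4 * c) (g - 2 * c) (by omega)).append hP hd.2
  have hwp : Disjoint (Finset.Ico e (e + 4 * c))
      (Finset.Ico (e + 4 * c) (e + 4 * c + 2 * (g - 2 * c)) ∪ P) := by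
    rw [Finset.disjoint_union_right]
    refine ⟨?_, hd.1⟩
    simp only [Finset.disjoint_left, Finset.mem_Ico]
    omega
  rw [Finset.union_assoc]
  generalize Finset.Ico (e + 4 * c) (e + 4 * c + 2 * (g - 2 * c)) ∪ P = Q at hpairs hwp ⊢
  -- `k` counts the quads outside the 2 × 6 pieces: `z` on top and `βx` below, in each of the `2c`
  -- blocks.
  obtain ⟨k, hk⟩ : ∃ k, k = 2 * c * z + 2 * c * (2 * (z + 1) + 1) * x := ⟨_, rfl⟩
  have hcount : g - 2 * c + q = (2 * c + 2 * c) + (k + k) := by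
    have : (2 * x + 1) * (2 * (z + 1) + 1) * c = 3 * c + k := by
      rw [hk]
      ring
    omega
  rw [hcount] at hpairs
  obtain ⟨Q₁, Q₂, hQ₁, hQ₂, hQ, rfl⟩ := hpairs.split
  rw [Finset.disjoint_union_right] at hwp
  have hsix : Tiled IsSextuple (2 * c) (Finset.Ico e (e + 4 * c) ∪ Q₁) :=
    hwide.zip hQ₁.quads hwp.1 fun R S hR hS hRS => ⟨R, S, hR, hS, hRS, rfl⟩
  have h₆ : ZeroSumArrays (2 * c) 2 6 (signedSet (Finset.Ico e (e + 4 * c) ∪ Q₁)) := by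
    simpa using hsix.zeroSumArrays fun R hR => hR.zeroSumArrays
  have h₄ : ZeroSumArrays k 2 4 (signedSet Q₂) := by
    simpa using hQ₂.quads.zeroSumArrays fun R hR => hR.zeroSumArrays
  rw [hk] at h₄
  obtain ⟨S₁, S₂, hS₁, hS₂, hS, hSu⟩ := h₄.split
  have hdis : Disjoint (signedSet (Finset.Ico e (e + 4 * c) ∪ Q₁)) (S₁ ∪ S₂) := by
    rw [hSu]
    exact disjoint_signedSet (Finset.disjoint_union_left.2 ⟨hwp.2, hQ⟩)
  rw [Set.disjoint_union_right] at hdis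
  have htop := h₆.hcat hS₁.join hdis.1
  have hbot := ZeroSumArrays.of_quads_of_even_left hS₂
  rw [← Finset.union_assoc, signedSet_union _ Q₂, ← hSu, ← Set.union_assoc]
  exact (htop.vcat (hbot.cast rfl rfl (by ring) rfl)
    (Set.disjoint_union_left.2 ⟨hdis.2, hS⟩)).cast rfl (by ring) (by ring) rfl

/-! ### Assembling the strips and the whole arrays -/

/-- The strips of width three. -/
theorem exists_strips {c α β k : ℕ} {U G : Finset ℕ} (hc : 1 ≤ c) (hβ : 2 ≤ β)
    (hU : Tiled IsTriple k U)
    (hG : k = 2 * (c * (α + β)) ∧ G = ∅ ∨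
      k + 4 = 2 * (c * (α + β)) ∧ ZeroSumArrays 2 3 4 (signedSet G)) (hd : Disjoint U G) :
    ∃ S₁ S₂, ZeroSumArrays (2 * c) 3 (2 * β) S₁ ∧ ZeroSumArrays (2 * c) (2 * α) 3 S₂ ∧
      Disjoint S₁ S₂ ∧ S₁ ∪ S₂ = signedSet (U ∪ G) := by
  have hU' : ZeroSumArrays k 3 2 (signedSet U) := by
    simpa using hU.zeroSumArrays fun R hR => hR.zeroSumArrays
  rcases hG with ⟨rfl, rfl⟩ | ⟨hk, hG⟩
  · rw [show 2 * (c * (α + β)) = 2 * c * β + 2 * c * α by ring] at hU'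
    obtain ⟨S₁, S₂, h₁, h₂, hS, hSu⟩ := hU'.split
    refine ⟨S₁, S₂, h₁.join.cast rfl rfl (by ring) rfl,
      h₂.join.transpose.cast rfl (by ring) rfl rfl, hS, ?_⟩
    rw [hSu, Finset.union_empty]
  -- Two of the 3 × 2β strips begin with a 3 × 4 array, which fits since `β ≥ 2`; they need `b`
  -- further triples each, the other `2d` strips `b + 2` each.
  · obtain ⟨b, rfl⟩ : ∃ b, β = b + 2 := ⟨β - 2, by omega⟩
    obtain ⟨d, rfl⟩ : ∃ d, c = d + 1 := ⟨c - 1, by omega⟩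
    rw [show k = (2 * b + 2 * d * (b + 2)) + 2 * (d + 1) * α by
      have : 2 * ((d + 1) * (α + (b + 2))) =
        (2 * b + 2 * d * (b + 2)) + 2 * (d + 1) * α + 4 := by ring
      omega] at hU'
    obtain ⟨S₁, S₂, h₁, h₂, hS, hSu⟩ := hU'.split
    obtain ⟨V₁, V₂, hV₁, hV₂, hV, rfl⟩ := h₁.split
    have hdis : Disjoint (signedSet G) (V₁ ∪ V₂ ∪ S₂) := by
      rw [hSu]
      exact (disjoint_signedSet hd).symm
    rw [Set.disjoint_union_right, Set.disjoint_union_right] at hdis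
    rw [Set.disjoint_union_left] at hS
    have hfirst := (hG.hcat hV₁.join hdis.1.1).append
      (hV₂.join.cast rfl rfl (by ring : (b + 2) * 2 = 4 + b * 2) rfl)
      (Set.disjoint_union_left.2 ⟨hdis.1.2, hV⟩)
    refine ⟨_, S₂, hfirst.cast (by ring) rfl (by ring) rfl,
      h₂.join.transpose.cast rfl (by ring) rfl rfl, ?_, ?_⟩
    · exact Set.disjoint_union_left.2 ⟨Set.disjoint_union_left.2 ⟨hdis.2, hS.1⟩, hS.2⟩
    · rw [signedSet_union, ← hSu, Set.union_assoc (signedSet G), Set.union_assoc (signedSet G),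
        Set.union_comm]

theorem zeroSumArrays_three_add {c α β : ℕ} (hc : 1 ≤ c) (hα : 1 ≤ α) (hβ : 2 ≤ β) :
    ZeroSumArrays (2 * c) (3 + 2 * α) (3 + 2 * β)
      (signedSet (Finset.Icc 1 ((3 + 2 * α) * (3 + 2 * β) * c))) := by
  obtain ⟨g, ⟨k, q, e, K, U, G, P, hK, hU, hG, hP, he, hq, d₁, d₂, d₃, d₄, hu⟩, hg⟩ :=
    -- The two bounds are `α + β ≥ 3` and `(α - 1)(β - 1) ≥ 0`, multiplied by `c`.
    exists_hasLayout (c := c) (p := c * (α + β)) (w := α * β * c) hc (by nlinarith) (by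
      obtain ⟨a, rfl⟩ := Nat.exists_eq_add_of_le hα
      obtain ⟨b, rfl⟩ := Nat.exists_eq_add_of_le hβ
      nlinarith [Nat.zero_le (a * b * c), Nat.zero_le (a * c), Nat.zero_le (b * c)])
  rw [Finset.disjoint_union_left] at d₂
  obtain ⟨S₁, S₂, h₁, h₂, hS, hSu⟩ := exists_strips hc hβ hU hG d₂.2
  rw [Finset.disjoint_union_left] at d₄
  have hblocks := exists_even_blocks hα hβ hP he hq hg d₄.2
  have hcore : ZeroSumArrays (2 * c) 3 3 (signedSet K) :=
    (hK.zeroSumArrays fun R hR => hR.zeroSumArrays).cast (by ring) rfl rfl rfl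
  have hKS : Disjoint (signedSet K) (S₁ ∪ S₂) := by
    rw [hSu]
    exact disjoint_signedSet (Finset.disjoint_union_right.2 ⟨d₁, d₂.1⟩)
  have hKB : Disjoint (signedSet K ∪ (S₁ ∪ S₂))
      (signedSet (Finset.Ico e (e + 2 * g) ∪ P)) := by
    rw [hSu, ← signedSet_union, ← Finset.union_assoc]
    exact disjoint_signedSet (Finset.disjoint_union_right.2 ⟨d₃, d₄.1⟩)
  rw [Set.disjoint_union_right] at hKS
  rw [Set.disjoint_union_left, Set.disjoint_union_left] at hKB
  have htop := hcore.hcat h₁ hKS.1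
  have hbot := h₂.hcat hblocks hKB.2.2
  refine (htop.vcat hbot ?_).cast rfl rfl rfl ?_
  · rw [Set.disjoint_union_left, Set.disjoint_union_right, Set.disjoint_union_right]
    exact ⟨⟨hKS.2, hKB.1⟩, hS, hKB.2.1⟩
  · rw [show (3 + 2 * α) * (3 + 2 * β) * c =
      4 * (α * β * c) + 6 * (c * (α + β)) + 9 * c by ring, ← hu, Set.union_assoc,
      ← Set.union_assoc S₁, hSu]
    simp only [signedSet_union, Set.union_assoc]

theorem ZeroSumArrays.exists_isSignedMagicArraySet {a b c : ℕ}
    (h : ZeroSumArrays (2 * c) a b (signedSet (Finset.Icc 1 (a * b * c)))) :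
    ∃ A : Fin (2 * c) → Matrix (Fin a) (Fin b) ℤ, IsSignedMagicArraySet a b (2 * c) A := by
  obtain ⟨A, hrow, hcol, hinj, hran⟩ := h
  have hsym : signedSymbols (a * b * (2 * c)) = signedSet (Finset.Icc 1 (a * b * c)) := by
    ext z
    have hev : ¬ Odd (a * b * (2 * c)) := by
      rw [Nat.not_odd_iff_even]
      exact ⟨a * b * c, by ring⟩
    have hdiv : ((a * b * (2 * c) : ℕ) : ℤ) / 2 = ((a * b * c : ℕ) : ℤ) := by
      rw [show a * b * (2 * c) = a * b * c * 2 by ring]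
      omega
    simp only [signedSymbols, signedSet, Set.mem_ofPred_eq, if_neg hev, hdiv, Finset.mem_Icc,
      Int.abs_eq_natAbs]
    generalize a * b * c = n
    omega
  refine ⟨A, ?_, ?_, hrow, hcol⟩
  · intro t i j
    rw [hsym, ← hran]
    exact ⟨(t, i, j), rfl⟩
  · intro ω hω
    rw [hsym, ← hran] at hω
    obtain ⟨q, hq⟩ := hω
    exact ⟨q, hq, fun r hr => hinj (hr.trans hq.symm)⟩

theorem proposition1p5 (a b c : ℕ) (hc : 0 < c) (ha : Odd a) (hb : Odd b)
    (ha5 : 5 ≤ a) (hb5 : 5 ≤ b) (hab : (a, b) ≠ (5, 5)) :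
    ∃ A : Fin (2 * c) → Matrix (Fin a) (Fin b) ℤ, IsSignedMagicArraySet a b (2 * c) A := by
  apply ZeroSumArrays.exists_isSignedMagicArraySet
  obtain ⟨α, rfl⟩ : ∃ α, a = 3 + 2 * α := by
    obtain ⟨k, rfl⟩ := ha
    exact ⟨k - 1, by omega⟩
  obtain ⟨β, rfl⟩ : ∃ β, b = 3 + 2 * β := by
    obtain ⟨k, rfl⟩ := hb
    exact ⟨k - 1, by omega⟩
  -- As (5, 5) is excluded, `α` or `β` is at least 2; transposition makes it the second one.
  rcases Nat.lt_or_ge β 2 with hβ | hβ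
  · have hα : 2 ≤ α := by
      by_contra hα
      exact hab (Prod.ext (by simp only; omega) (by simp only; omega))
    rw [mul_comm (3 + 2 * α)]
    exact (zeroSumArrays_three_add hc (by omega) hα).transpose
  · exact zeroSumArrays_three_add hc (by omega) hβ
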